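/- Let $U$ be a finite set of keys and $[k]=\{0,\dots,k-1\}$. A non-empty class $\mathcal F$ of functions $U\to[\ell]$ is called $2$-universal if $\Pr_{g\in\mathcal F}(g(x)=g(y))\le 2/\ell$ for all distinct $x,y\in U$, and a non-empty class $\mathcal H$ of functions $U\to[m]$ is called $2$-wise independent if $\Pr_{f\in\mathcal H}(f(x_1)=j_1\wedge f(x_2)=j_2)=1/m^2$ for all distinct $x_1,x_2\in U$ and all $j_1,j_2\in[m]$ (here and below, probabilities refer to uniform random choice from the class). Given such classes $\mathcal F$ and $\mathcal H$, let $\mathcal Z^{c,d}_{\ell,m}$ be the class of all hash function sequences $\vec h=(h_1,\dots,h_d)$ given by components $f_1,\dots,f_d\in\mathcal H$, $g_1,\dots,g_c\in\mathcal F$ and tables $z^{(i)}\in[m]^{c\times\ell}$, $1\le i\le d$, through $$h_i(x)=\Bigl(f_i(x)+\sum_{j=1}^{c} z^{(i)}[j,g_j(x)]\Bigr)\bmod m ,\qquad x\in U,$$ where choosing $\vec h$ at random from $\mathcal Z^{c,d}_{\ell,m}$ means choosing the components $(f_i)_i,(g_j)_j,(z^{(i)})_i$ uniformly at random. For $S\subseteq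 U$, let $G(S,\vec h)$ be the $d$-partite multi-hypergraph whose vertex set consists of $d$ disjoint copies of $[m]$ and which has, for each key $x\in S$, one edge consisting of the vertices $h_i(x)$ in the $i$-th copy, $1\le i\le d$. It is called $1$-orientable if there is an injective map from its edges (one for each key of $S$) to its vertices that sends each edge to a vertex on it; in this case $\vec h$ is called suitable for $S$. **Theorem.** Let $\varepsilon>0$, $0<\delta<1$, and let $d\ge 3$ and $c\ge 2/\delta$ be integers. There is a constant $C=C(\varepsilon,\delta,d,c)$ such that the following holds. Let $n\ge 1$ and $m\ge(1+\varepsilon)(d-1)n$ be integers, let $\ell=n^\delta$, rounded down or up to an integer, let $U$ be a finite set, let $\mathcal F$ be any $2$-universal class of functions $U\to[\ell]$ and $\mathcal H$ any $2$-wise independent class of functions $U\to[m]$, and let $S\subseteq U$ with $|S|=n$. Then, for $\vec h$ chosen at random from $\mathcal Z^{c,d}_{\ell,m}$, $$\Pr\bigl(\vec h\text{ is not suitable for }S\bigr)\le \frac{C}{n}.$$ -/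

import Mathlib

/-- The probability of the event `P` under the uniform distribution on the finite
(non-empty) set `A`. -/
noncomputable def uniformProb {Ω : Type*} (A : Finset Ω) (P : Ω → Prop) : ℝ :=
  open Classical in ((A.filter P).card : ℝ) / (A.card : ℝ)

/-- A hash class `H` of functions from `U` to `[m]` is `a`-universal if distinct keys collide
with probability at most `a / m`. -/
def IsUniversalClass {U : Type*} {m : ℕ} (a : ℝ) (H : Finset (U → Fin m)) : Prop :=
  ∀ x y : U, x ≠ y → uniformProb H (fun h => h x = h y) ≤ a / (m : ℝ)

/-- A hash class `H` of functions from `U` to `[m]` is `κ`-wise independent if the hash values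
of any `κ` distinct keys are uniform in `[m]^κ`. -/
def IsIndependentClass {U : Type*} {m : ℕ} (κ : ℕ) (H : Finset (U → Fin m)) : Prop :=
  ∀ x : Fin κ → U, Function.Injective x → ∀ j : Fin κ → Fin m,
    uniformProb H (fun h => ∀ i, h (x i) = j i) = 1 / (m : ℝ) ^ κ

/-- The components `f_1, …, f_d`, `g_1, …, g_c`, `z^{(1)}, …, z^{(d)}` of a hash function
sequence: `f i : U → [m]`, `g j : U → [ℓ]`, and `z i` is a `c × ℓ` table over `[m]`. -/
abbrev HashComponents (U : Type*) (c d ℓ m : ℕ) : Type _ :=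
  (Fin d → U → Fin m) × (Fin c → U → Fin ℓ) × (Fin d → Fin c → Fin ℓ → Fin m)

/-- The hash function sequence `(h_1, …, h_d)⟨f, g, z⟩`:
`h_i(x) = (f_i(x) + ∑_j z^{(i)}[j, g_j(x)]) mod m`. -/
def hashSeq {U : Type*} {c d ℓ m : ℕ} (w : HashComponents U c d ℓ m) :
    Fin d → U → Fin m :=
  fun i x =>
    ⟨((w.1 i x : ℕ) + ∑ j : Fin c, (w.2.2 i j (w.2.1 j x) : ℕ)) % m,
      Nat.mod_lt _ (w.1 i x).pos⟩

/-- The hash class `Z^{c,d}_{ℓ,m}(F, H)`: the `f_i` are taken from `H`, the `g_j` from `F`, and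
the tables are arbitrary. An element is kept together with its components. -/
def hashClassZ {U : Type*} (c d : ℕ) {ℓ m : ℕ} (F : Finset (U → Fin ℓ))
    (H : Finset (U → Fin m)) : Finset (HashComponents U c d ℓ m) :=
  Fintype.piFinset (fun _ : Fin d => H) ×ˢ
    (Fintype.piFinset (fun _ : Fin c => F) ×ˢ Finset.univ)

/-- A multi-hypergraph with vertex set `V` whose edges carry distinct labels from `E`;
differently labelled edges may have the same vertices. -/
structure MultiHypergraph (V E : Type*) where
  /-- The set of vertices on the edge with the given label. -/
  edge : E → Set V

/-- A hypergraph is `1`-orientable if there is an injective map sending every edge to a vertex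
on that edge. -/
def MultiHypergraph.OneOrientable {V E : Type*} (G : MultiHypergraph V E) : Prop :=
  ∃ φ : E → V, Function.Injective φ ∧ ∀ e, φ e ∈ G.edge e

/-- The `d`-partite hypergraph `G(S, h)`: the vertices are `d` disjoint copies of `[m]`, and each
key `x ∈ S` contributes the edge `(h_1(x), …, h_d(x))`, with `h_i(x)` in the `i`-th copy. -/
def hashHypergraph {U : Type*} {d m : ℕ} (S : Finset U) (h : Fin d → U → Fin m) :
    MultiHypergraph (Fin d × Fin m) S where
  edge x := Set.range (fun i : Fin d => (i, h i (x : U)))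

/-- `h` is suitable for `S` if `G(S, h)` is `1`-orientable. -/
def IsSuitable {U : Type*} {d m : ℕ} (S : Finset U) (h : Fin d → U → Fin m) : Prop :=
  (hashHypergraph S h).OneOrientable

open Finset

/-! ### Uniform probability on finite sets. -/

section UniformProb

variable {Ω ι : Type*}

/-! The proof is a first-moment argument over paths. Peeling off edges that have a private vertex
leaves a nonempty core when `G(S, h)` is not `1`-orientable (`exists_core_of_not_isSuitable`). An
inextensible alternating path in the core must meet itself again at its last edge in two further
parts, because `d ≥ 3` (`exists_closed_path`). With `k + 2` keys this gives `k + 3` equations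
between hash values. Under full randomness the expected number of such configurations is of order
`k² ((d - 1) n / m) ^ k / n`, which sums to `O(1 / n)`.

The hash values are fully random only on keys that some `g_j` nearly separates: random table cells
cover all keys except one pair, and pairwise independence of the `f_i` covers that pair
(`card_row_mul_le`, `uniformProb_hashClassZ_le`). If the path is not separated, some prefix is
separated although no `g_j` is injective on it (`separated_or_exists_prefix`). The prefix has one
equation fewer than keys, an excess of order `n`, but the `c` independent failures of injectivity
cost `O(k ^ (2 c) ℓ ^ (-c))`, and `ℓ ^ (-c) = O(n ^ (-2))` since `c δ ≥ 2`. Again `O(1 / n)`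
remains. -/

theorem uniformProb_eq (A : Finset Ω) (P : Ω → Prop) [DecidablePred P] :
    uniformProb A P = (#(A.filter P) : ℝ) / #A := by
  unfold uniformProb
  congr!

theorem uniformProb_mono (A : Finset Ω) {P Q : Ω → Prop} (h : ∀ w ∈ A, P w → Q w) :
    uniformProb A P ≤ uniformProb A Q := by
  classical
  simp only [uniformProb_eq]
  gcongr with w hw
  exact h w hw

theorem uniformProb_or_le (A : Finset Ω) (P Q : Ω → Prop) :
    uniformProb A (fun w => P w ∨ Q w) ≤ uniformProb A P + uniformProb A Q := by
  classical
  simp only [uniformProb_eq]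
  rw [← add_div]
  gcongr
  rw [filter_or]
  exact_mod_cast card_union_le _ _

theorem uniformProb_exists_le (A : Finset Ω) (I : Finset ι) (P : ι → Ω → Prop) :
    uniformProb A (fun w => ∃ i ∈ I, P i w) ≤ ∑ i ∈ I, uniformProb A (P i) := by
  classical
  simp only [uniformProb_eq]
  rw [← sum_div]
  gcongr
  have : A.filter (fun w => ∃ i ∈ I, P i w) ⊆ I.biUnion (fun i => A.filter (P i)) := by
    intro w; simp only [mem_filter, mem_biUnion]; tauto
  exact_mod_cast (card_le_card this).trans card_biUnion_le

theorem uniformProb_nonneg (A : Finset Ω) (P : Ω → Prop) : 0 ≤ uniformProb A P := by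
  unfold uniformProb; positivity

/-- Union bound with a common bound for all events. -/
theorem uniformProb_exists_le_card_mul (A : Finset Ω) (I : Finset ι) (P : ι → Ω → Prop) {b : ℝ}
    (h : ∀ i ∈ I, uniformProb A (P i) ≤ b) :
    uniformProb A (fun w => ∃ i ∈ I, P i w) ≤ #I * b := by
  refine (uniformProb_exists_le A I P).trans ?_
  simpa [nsmul_eq_mul] using sum_le_card_nsmul I _ b h

/-- The coordinates of a uniformly chosen tuple are independent. -/
theorem uniformProb_piFinset_forall {c : ℕ} (F : Finset Ω) (P : Ω → Prop) :
    uniformProb (Fintype.piFinset fun _ : Fin c => F) (fun q => ∀ j, P (q j)) =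
      uniformProb F P ^ c := by
  classical
  simp only [uniformProb_eq]
  have : (Fintype.piFinset fun _ : Fin c => F).filter (fun q => ∀ j, P (q j)) =
      Fintype.piFinset fun _ : Fin c => F.filter P := by
    ext q; simp [Fintype.mem_piFinset, forall_and]
  rw [this]
  simp [Fintype.card_piFinset, div_pow]

end UniformProb

/-! ### Randomness of hash values on separated keys. -/

section Rows

variable {U : Type*} {c d ℓ m t : ℕ}

theorem Fin.val_sum_eq_mod [NeZero m] {ι : Type*} (s : Finset ι) (f : ι → Fin m) :
    ((∑ i ∈ s, f i : Fin m) : ℕ) = (∑ i ∈ s, (f i : ℕ)) % m := by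
  classical
  induction s using Finset.induction_on with
  | empty => simp
  | insert a s ha ih => rw [sum_insert ha, sum_insert ha, Fin.val_add, ih]; simp

theorem hashSeq_eq_add [NeZero m] (w : HashComponents U c d ℓ m) (i : Fin d) (x : U) :
    hashSeq w i x = w.1 i x + ∑ j, w.2.2 i j (w.2.1 j x) := by
  apply Fin.ext
  rw [Fin.val_add, Fin.val_sum_eq_mod]
  simp [hashSeq]

/-- Some `q j` separates all keys of the sequence `x`, except possibly for one pair of them
that may collide with each other. -/
def Separated (q : Fin c → U → Fin ℓ) (x : Fin t → U) : Prop :=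
  ∃ j a b, a ≠ b ∧ ∀ s, s ≠ a → s ≠ b → ∀ s', s' ≠ s → q j (x s') ≠ q j (x s)

/-- Under pairwise independence, a row of hash values takes prescribed values at two keys with
probability `1 / m ^ 2`, whatever the tables are. -/
theorem card_row_pair_mul [NeZero m] {H : Finset (U → Fin m)} (hne : H.Nonempty)
    (hH : IsIndependentClass 2 H) {Z : Type*} [Fintype Z] (r : Z → U → Fin m) {y y' : U}
    (hy : y ≠ y') (v v' : Fin m) :
    #{p ∈ H ×ˢ (univ : Finset Z) | p.1 y + r p.2 y = v ∧ p.1 y' + r p.2 y' = v'} * m ^ 2 =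
      #H * Fintype.card Z := by
  classical
  have key : ∀ u u' : Fin m, #{f ∈ H | f y = u ∧ f y' = u'} * m ^ 2 = #H := by
    intro u u'
    have h := hH ![y, y'] (by
      intro i j hij
      fin_cases i <;> fin_cases j <;> simp_all [eq_comm]) ![u, u']
    rw [uniformProb_eq] at h
    have hm : (m : ℝ) ^ 2 ≠ 0 := by simp [NeZero.ne m]
    have hc : (#H : ℝ) ≠ 0 := by simpa using hne.ne_empty
    rw [div_eq_div_iff hc hm] at h
    simp only [Fin.forall_fin_two, Matrix.cons_val_zero, Matrix.cons_val_one, one_mul] at h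
    exact_mod_cast h
  have hfib := card_eq_sum_card_fiberwise (f := Prod.snd) (t := (univ : Finset Z))
    (s := (H ×ˢ (univ : Finset Z)).filter
      fun p : (U → Fin m) × Z => p.1 y + r p.2 y = v ∧ p.1 y' + r p.2 y' = v')
    (by intro p _; simp)
  rw [hfib, sum_mul]
  -- For fixed tables the condition concerns `f` alone, with targets translated by the table
  -- contributions.
  have : ∀ z ∈ (univ : Finset Z), #{p ∈ {p ∈ H ×ˢ (univ : Finset Z) |
      p.1 y + r p.2 y = v ∧ p.1 y' + r p.2 y' = v'} | p.2 = z} * m ^ 2 = #H := by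
    intro z _
    rw [← key (v - r z y) (v' - r z y')]
    congr 1
    refine card_bij (fun p _ => p.1) ?_ ?_ ?_
    · rintro ⟨f, z'⟩ h
      simp only [mem_filter, mem_product, mem_univ, and_true] at h ⊢
      obtain ⟨⟨hf, h1, h2⟩, rfl⟩ := h
      exact ⟨hf, eq_sub_of_add_eq h1, eq_sub_of_add_eq h2⟩
    · rintro ⟨f, z'⟩ h ⟨f', z''⟩ h' e
      simp only [mem_filter] at h h'
      ext1
      · exact e
      · exact h.2.trans h'.2.symm
    · intro f hf
      simp only [mem_filter] at hf
      refine ⟨(f, z), ?_, rfl⟩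
      simp [hf.1, hf.2.1, hf.2.2]
  rw [sum_congr rfl this]
  simp [mul_comm]

/-- If `q` separates the keys `x`, then the row of hash values at these keys is uniform. -/
theorem card_row_mul_le [NeZero m] {H : Finset (U → Fin m)} (hne : H.Nonempty)
    (hH : IsIndependentClass 2 H) {q : Fin c → U → Fin ℓ} {x : Fin t → U}
    (hx : Function.Injective x) (hq : Separated q x) (v : Fin t → Fin m) :
    #{p ∈ H ×ˢ (univ : Finset (Fin c → Fin ℓ → Fin m)) |
      ∀ s, p.1 (x s) + ∑ j, p.2 j (q j (x s)) = v s} * m ^ t ≤ #H * m ^ (c * ℓ) := by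
  classical
  obtain ⟨j, a, b, hab, hsep⟩ := hq
  have hpair := card_row_pair_mul hne hH
    (fun (z : Fin c → Fin ℓ → Fin m) y => ∑ j, z j (q j y)) (hx.ne hab) (v a) (v b)
  have hZ : Fintype.card (Fin c → Fin ℓ → Fin m) = m ^ (c * ℓ) := by
    simp [← pow_mul, mul_comm]
  rw [hZ] at hpair
  rw [← hpair]
  have hsub : Fintype.card {s : Fin t // s ≠ a ∧ s ≠ b} + 2 = t := by
    rw [Fintype.card_subtype]
    have : (univ.filter fun s : Fin t => s ≠ a ∧ s ≠ b) = (univ.erase a).erase b := by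
      ext s; simp [and_comm]
    rw [this, card_erase_of_mem (by simp [hab.symm]), card_erase_of_mem (by simp)]
    have h1 := a.isLt
    have h2 := b.isLt
    have h3 : (a : ℕ) ≠ b := fun h => hab (Fin.ext h)
    simp only [card_univ, Fintype.card_fin]
    omega
  set N := {p ∈ H ×ˢ (univ : Finset (Fin c → Fin ℓ → Fin m)) |
      ∀ s, p.1 (x s) + ∑ j, p.2 j (q j (x s)) = v s} with hN
  have hpow : m ^ t = m ^ Fintype.card {s : Fin t // s ≠ a ∧ s ≠ b} * m ^ 2 := by
    rw [← pow_add, hsub]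
  rw [hpow, ← mul_assoc]
  refine Nat.mul_le_mul_right _ ?_
  have hcard : #N * m ^ Fintype.card {s : Fin t // s ≠ a ∧ s ≠ b} =
      #(N ×ˢ (univ : Finset ({s : Fin t // s ≠ a ∧ s ≠ b} → Fin m))) := by
    simp [card_product]
  rw [hcard]
  -- Adding `u s` to the cell `q j (x s)` of table row `j` changes the value at key `s` only:
  -- separation makes this cell private to `s`. So `N` times all `u` injects into the rows
  -- prescribed only at `a` and `b`, which `hpair` counts.
  set shift : ({s : Fin t // s ≠ a ∧ s ≠ b} → Fin m) → Fin c → Fin ℓ → Fin m :=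
    fun u j' y => if j' = j then ∑ s : {s : Fin t // s ≠ a ∧ s ≠ b}, (if q j (x s) = y then u s else 0) else 0 with hshift
  have hsum : ∀ u (y : U), ∑ j', shift u j' (q j' y) =
      ∑ s : {s : Fin t // s ≠ a ∧ s ≠ b}, if q j (x s) = q j y then u s else 0 := by
    intro u y
    rw [Finset.sum_eq_single j]
    · simp [hshift]
    · intro j' _ hj'; simp [hshift, hj']
    · simp
  have hin : ∀ u (s : {s : Fin t // s ≠ a ∧ s ≠ b}),
      ∑ j', shift u j' (q j' (x s)) = u s := by
    intro u s
    rw [hsum, Finset.sum_eq_single s]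
    · simp
    · intro s' _ hs'
      rw [if_neg]
      exact hsep s s.2.1 s.2.2 s' (fun h => hs' (Subtype.ext h))
    · simp
  have hout : ∀ u (s : Fin t), (s = a ∨ s = b) → ∑ j', shift u j' (q j' (x s)) = 0 := by
    intro u s hs
    rw [hsum]
    refine Finset.sum_eq_zero fun s' _ => if_neg fun h => ?_
    refine hsep s' s'.2.1 s'.2.2 s ?_ h.symm
    rintro rfl
    exact hs.elim s'.2.1 s'.2.2
  refine card_le_card_of_injOn (fun p => (p.1.1, p.1.2 + shift p.2)) ?_ ?_
  · rintro ⟨⟨f, z⟩, u⟩ h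
    simp only [hN, mem_coe, mem_product, mem_filter, mem_univ, and_true] at h ⊢
    refine ⟨h.1, ?_, ?_⟩
    · simp only [Pi.add_apply, sum_add_distrib]
      rw [hout u a (Or.inl rfl), add_zero, h.2 a]
    · simp only [Pi.add_apply, sum_add_distrib]
      rw [hout u b (Or.inr rfl), add_zero, h.2 b]
  · rintro ⟨⟨f, z⟩, u⟩ h ⟨⟨f', z'⟩, u'⟩ h' e
    simp only [hN, mem_coe, mem_product, mem_filter, mem_univ, and_true] at h h'
    simp only [Prod.mk.injEq] at e
    obtain ⟨rfl, e⟩ := e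
    -- The unshifted values are the prescribed `v s`, so the shifted value at `x s` reveals `u s`.
    have hu : u = u' := by
      ext1 s
      have e1 : f (x s) + ∑ j', (z + shift u) j' (q j' (x s)) =
        f (x s) + ∑ j', (z' + shift u') j' (q j' (x s)) := by rw [e]
      simp only [Pi.add_apply, sum_add_distrib, hin] at e1
      rw [← add_assoc, ← add_assoc, h.2 s, h'.2 s] at e1
      exact add_left_cancel e1
    subst hu
    rw [add_right_cancel e]

/-- Full randomness: for key sequences separated by the `g`-part, an event that depends on the
hash values of these keys is at most as likely as for uniform hash values. -/
theorem uniformProb_hashClassZ_le [NeZero m] {F : Finset (U → Fin ℓ)} {H : Finset (U → Fin m)}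
    (hne : H.Nonempty) (hH : IsIndependentClass 2 H) {x : Fin t → U}
    (hx : Function.Injective x) (Q : (Fin c → U → Fin ℓ) → Prop) (hQ : ∀ q, Q q → Separated q x)
    (R : (Fin d → Fin t → Fin m) → Prop) :
    uniformProb (hashClassZ c d F H)
        (fun w => Q w.2.1 ∧ R (fun i s => hashSeq w i (x s))) ≤
      uniformProb (Fintype.piFinset fun _ : Fin c => F) Q * uniformProb univ R := by
  classical
  set X := #H * m ^ (c * ℓ) with hX
  have hm : 0 < m := Nat.pos_of_ne_zero (NeZero.ne m)
  -- Once the `g`-part and the value matrix are fixed, the `d` pairs of `f i` and table `z i` can be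
  -- counted independently. The truncated quotient `X / m ^ t` is harmless, as only an upper bound
  -- is needed.
  have hcount := card_le_mul_card_image_of_maps_to
    (s := (hashClassZ c d F H).filter
      (fun w => Q w.2.1 ∧ R (fun i s => hashSeq w i (x s))))
    (f := fun w => (w.2.1, fun i s => hashSeq w i (x s)))
    (t := ((Fintype.piFinset fun _ : Fin c => F).filter Q) ×ˢ (univ.filter R))
    (by
      rintro ⟨f, q, z⟩ h
      simp only [hashClassZ, mem_filter, mem_product, mem_univ, true_and, and_true] at h ⊢
      exact ⟨⟨h.1.2, h.2.1⟩, h.2.2⟩)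
    ((X / m ^ t) ^ d) (by
      rintro ⟨q, v⟩ hqv
      simp only [mem_product, mem_filter] at hqv
      have hsep := hQ q hqv.1.2
      have hrow : ∀ i, #{p ∈ H ×ˢ (univ : Finset (Fin c → Fin ℓ → Fin m)) |
          ∀ s, p.1 (x s) + ∑ j, p.2 j (q j (x s)) = v i s} ≤ X / m ^ t := fun i =>
        (Nat.le_div_iff_mul_le (pow_pos hm t)).2 (card_row_mul_le hne hH hx hsep (v i))
      have hprod : #(Fintype.piFinset fun i : Fin d =>
          {p ∈ H ×ˢ (univ : Finset (Fin c → Fin ℓ → Fin m)) |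
          ∀ s, p.1 (x s) + ∑ j, p.2 j (q j (x s)) = v i s}) ≤ (X / m ^ t) ^ d := by
        rw [Fintype.card_piFinset]
        simpa using prod_le_pow_card univ _ _ (fun i _ => hrow i)
      refine le_trans ?_ hprod
      refine card_le_card_of_injOn (fun w i => (w.1 i, w.2.2 i)) ?_ ?_
      · rintro ⟨f, q', z⟩ h
        simp only [hashClassZ, mem_filter, mem_product, mem_univ, and_true,
          mem_coe, Fintype.mem_piFinset, Prod.mk.injEq] at h ⊢
        obtain ⟨⟨h1, h2⟩, rfl, h4⟩ := h
        intro i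
        refine ⟨h1.1 i, fun s => ?_⟩
        rw [← h4]
        exact (hashSeq_eq_add (f, q', z) i (x s)).symm
      · rintro ⟨f, q', z⟩ h ⟨f', q'', z'⟩ h' e
        simp only [mem_filter, mem_coe, Prod.mk.injEq] at h h'
        have e' := fun i => congrFun e i
        simp only [Prod.mk.injEq] at e'
        have h5 : q' = q'' := h.2.1.trans h'.2.1.symm
        have h6 : f = f' := funext fun i => (e' i).1
        have h7 : z = z' := funext fun i => (e' i).2
        rw [h5, h6, h7])
  rw [card_product] at hcount
  simp only [uniformProb_eq]
  have hA : #(hashClassZ c d F H) =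
      #(Fintype.piFinset fun _ : Fin c => F) * X ^ d := by
    simp [hashClassZ, card_product, Fintype.card_piFinset, hX, mul_pow]
    ring
  have hV : #(univ : Finset (Fin d → Fin t → Fin m)) = (m ^ t) ^ d := by simp
  rw [hA, hV, div_mul_div_comm]
  have hXpos : 0 < X := Nat.mul_pos hne.card_pos (pow_pos hm _)
  by_cases hF : #(Fintype.piFinset fun _ : Fin c => F) = 0
  · simp [hF]
  have hF' := Nat.pos_of_ne_zero hF
  rw [div_le_div_iff₀ (by exact_mod_cast Nat.mul_pos hF' (pow_pos hXpos d))
    (by exact_mod_cast Nat.mul_pos hF' (pow_pos (pow_pos hm t) d))]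
  norm_cast
  calc _ ≤ ((X / m ^ t) ^ d * (#((Fintype.piFinset fun _ : Fin c => F).filter Q) *
        #(univ.filter R))) * (#(Fintype.piFinset fun _ : Fin c => F) * (m ^ t) ^ d) :=
        Nat.mul_le_mul_right _ hcount
    _ = #((Fintype.piFinset fun _ : Fin c => F).filter Q) * #(univ.filter R) *
        (#(Fintype.piFinset fun _ : Fin c => F) * (X / m ^ t * m ^ t) ^ d) := by
        rw [mul_pow]; ring
    _ ≤ _ := by gcongr; exact Nat.div_mul_le_self _ _

/-- The probability that uniform values satisfy a system of equations, each of which equates the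
value at a place of its own with one at an earlier position of the same row. -/
theorem uniformProb_equations_le [NeZero m] {κ : Type*} [Fintype κ] (e : κ → Fin d × Fin t)
    (he : Function.Injective e) (par : κ → Fin t) (hpar : ∀ k, par k < (e k).2) :
    uniformProb (univ : Finset (Fin d → Fin t → Fin m))
        (fun v => ∀ k, v (e k).1 (e k).2 = v (e k).1 (par k)) ≤
      1 / (m : ℝ) ^ Fintype.card κ := by
  classical
  have hm : 0 < m := Nat.pos_of_ne_zero (NeZero.ne m)
  simp only [uniformProb_eq]
  rw [div_le_div_iff₀ (by simp only [card_univ, Fintype.card_pi_const]; positivity) (by positivity), one_mul]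
  set E := (univ : Finset (Fin d → Fin t → Fin m)).filter
    (fun v => ∀ k, v (e k).1 (e k).2 = v (e k).1 (par k)) with hE
  have : #E * m ^ Fintype.card κ = #(E ×ˢ (univ : Finset (κ → Fin m))) := by
    simp [card_product]
  have h2 : #(E ×ˢ (univ : Finset (κ → Fin m))) ≤
      #(univ : Finset (Fin d → Fin t → Fin m)) := by
    -- Overwrite each place `e k` by a free value `u k`. The values `u` can be read off, and the
    -- solution `v` is recovered by induction on the position, since each lost value equals one at
    -- an earlier position.
    refine card_le_card_of_injOn
      (fun p i s => if h : ∃ k, e k = (i, s) then p.2 h.choose else p.1 i s) (by simp) ?_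
    rintro ⟨v, u⟩ h ⟨v', u'⟩ h' heq
    simp only [hE, mem_coe, mem_product, mem_filter, mem_univ, true_and, and_true] at h h'
    have heq' := fun i s => congrFun (congrFun heq i) s
    simp only at heq'
    have hu : u = u' := by
      ext1 k
      have hex : ∃ k', e k' = ((e k).1, (e k).2) := ⟨k, rfl⟩
      have h3 := heq' (e k).1 (e k).2
      rw [dif_pos hex, dif_pos hex, he hex.choose_spec] at h3
      exact h3
    have hv : ∀ n : ℕ, ∀ s : Fin t, (s : ℕ) = n → ∀ i, v i s = v' i s := by
      intro n
      induction n using Nat.strong_induction_on with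
      | _ n ih =>
        intro s hs i
        by_cases hex : ∃ k, e k = (i, s)
        · obtain ⟨k, hk⟩ := hex
          have h3 := h k
          have h4 := h' k
          have h5 := hpar k
          rw [hk] at h3 h4 h5
          simp only at h3 h4 h5
          rw [h3, h4]
          exact ih (par k) (by rw [← hs]; exact h5) _ rfl i
        · have h3 := heq' i s
          rwa [dif_neg hex, dif_neg hex] at h3
    rw [hu, show v = v' from funext fun i => funext fun s => hv s s rfl i]
  exact_mod_cast this.trans_le h2

/-- A universal class is injective on `t` keys except with probability `a t ^ 2 / ℓ`. -/
theorem IsUniversalClass.uniformProb_not_injective_le {a : ℝ} (ha : 0 ≤ a)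
    {F : Finset (U → Fin ℓ)} (hF : IsUniversalClass a F) {x : Fin t → U}
    (hx : Function.Injective x) :
    uniformProb F (fun g => ¬ Function.Injective (g ∘ x)) ≤ t ^ 2 * (a / ℓ) := by
  classical
  have h := uniformProb_exists_le_card_mul F
    ((univ : Finset (Fin t × Fin t)).filter fun p => p.1 ≠ p.2)
    (fun p g => g (x p.1) = g (x p.2)) (b := a / ℓ)
    (fun p hp => hF _ _ (hx.ne (by simpa using hp)))
  refine (uniformProb_mono F fun g _ hg => ?_).trans (h.trans ?_)
  · simp only [Function.Injective] at hg
    push Not at hg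
    obtain ⟨s, s', h1, h2⟩ := hg
    exact ⟨(s, s'), by simp [h2], h1⟩
  · gcongr
    have := card_filter_le (univ : Finset (Fin t × Fin t)) fun p => p.1 ≠ p.2
    simp only [card_univ, Fintype.card_prod, Fintype.card_fin, ← sq] at this
    exact_mod_cast this

end Rows

/-! ### Cores and alternating paths. -/

section Core

variable {U : Type*} {d m : ℕ}

/-- The vertex of `x` in part `i` is private to `x`, so an orientation of the other edges never uses
it and extends to `x`. -/
theorem isSuitable_of_erase [DecidableEq U] {S : Finset U} {h : Fin d → U → Fin m} {x : U}
    (i : Fin d) (hx : ∀ y ∈ S, y ≠ x → h i y ≠ h i x) (hS : IsSuitable (S.erase x) h) :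
    IsSuitable S h := by
  obtain ⟨φ, hφ, hmem⟩ := hS
  have hfresh : ∀ y : S.erase x, φ y ≠ (i, h i x) := by
    intro y hy
    obtain ⟨i', hi'⟩ := hmem y
    simp only [hy, Prod.mk.injEq] at hi'
    obtain ⟨rfl, hi'⟩ := hi'
    exact hx y (mem_of_mem_erase y.2) (ne_of_mem_erase y.2) hi'
  refine ⟨fun y => if hy : (y : U) = x then (i, h i x) else φ ⟨y, mem_erase.2 ⟨hy, y.2⟩⟩, ?_, ?_⟩
  · intro y y' e
    simp only at e
    split_ifs at e with h1 h2 h2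
    · exact Subtype.ext (h1.trans h2.symm)
    · exact absurd e.symm (hfresh _)
    · exact absurd e (hfresh _)
    · have := congrArg Subtype.val (hφ e)
      exact Subtype.ext this
  · intro y
    simp only
    split_ifs with h1
    · exact ⟨i, by simp [h1]⟩
    · exact hmem ⟨y, mem_erase.2 ⟨h1, y.2⟩⟩

/-- If the hypergraph is not `1`-orientable, it has a non-empty set of edges such that every
vertex on one of them lies on at least two of them. -/
theorem exists_core_of_not_isSuitable {h : Fin d → U → Fin m} (S : Finset U)
    (hS : ¬ IsSuitable S h) :
    ∃ T ⊆ S, T.Nonempty ∧ ∀ x ∈ T, ∀ i, ∃ y ∈ T, y ≠ x ∧ h i y = h i x := by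
  classical
  induction S using Finset.strongInduction with
  | H S ih =>
    by_cases hcore : ∀ x ∈ S, ∀ i, ∃ y ∈ S, y ≠ x ∧ h i y = h i x
    · refine ⟨S, Subset.rfl, ?_, hcore⟩
      rw [nonempty_iff_ne_empty]
      rintro rfl
      exact hS ⟨fun y => absurd y.2 (notMem_empty _),
        fun y => absurd y.2 (notMem_empty _), fun y => absurd y.2 (notMem_empty _)⟩
    · push Not at hcore
      obtain ⟨x, hx, i, hi⟩ := hcore
      obtain ⟨T, hT, hT'⟩ := ih (S.erase x) (erase_ssubset hx)
        (fun h' => hS (isSuitable_of_erase i hi h'))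
      exact ⟨T, hT.trans (erase_subset _ _), hT'⟩

/-- A path in the hypergraph: a sequence of keys in which consecutive edges meet in the part
given by `i`, where consecutive meeting parts differ. -/
structure IsHashPath (h : Fin d → U → Fin m) {k : ℕ} (x : Fin (k + 2) → U)
    (i : Fin (k + 1) → Fin d) : Prop where
  injective : Function.Injective x
  meet : ∀ s : Fin (k + 1), h (i s) (x s.succ) = h (i s) (x s.castSucc)

/-- Consecutive entries are distinct. -/
def IsAlternating {k d : ℕ} (i : Fin (k + 1) → Fin d) : Prop :=
  ∀ s : Fin k, i s.succ ≠ i s.castSucc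

theorem exists_ne_ne_ne (hd : 3 ≤ d) (j : Fin d) : ∃ a b : Fin d, a ≠ b ∧ a ≠ j ∧ b ≠ j := by
  have h : 1 < #(univ.erase j) := by
    rw [card_erase_of_mem (mem_univ _), card_univ, Fintype.card_fin]; omega
  obtain ⟨a, ha, b, hb, hab⟩ := one_lt_card.1 h
  exact ⟨a, b, hab, ne_of_mem_erase ha, ne_of_mem_erase hb⟩

theorem IsHashPath.snoc {h : Fin d → U → Fin m} {k : ℕ} {x : Fin (k + 2) → U}
    {i : Fin (k + 1) → Fin d} (hp : IsHashPath h x i) {y : U} {a : Fin d}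
    (hy : ∀ s, x s ≠ y) (ha : h a y = h a (x (Fin.last _))) :
    IsHashPath h (k := k + 1) (Fin.snoc (α := fun _ => U) x y)
      (Fin.snoc (α := fun _ => Fin d) i a) := by
  constructor
  · intro s s'
    induction s using Fin.lastCases <;> induction s' using Fin.lastCases
    · simp
    · simp [(hy _).symm]
    · simp [hy _]
    · simpa using fun e => hp.injective e
  · intro s
    induction s using Fin.lastCases with
    | last =>
      rw [Fin.snoc_last, Fin.succ_last, Fin.snoc_last, Fin.snoc_castSucc]; exact ha
    | cast s =>
      rw [Fin.snoc_castSucc, Fin.succ_castSucc, Fin.snoc_castSucc, Fin.snoc_castSucc]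
      exact hp.meet s

theorem IsAlternating.snoc {k : ℕ} {i : Fin (k + 1) → Fin d} (hi : IsAlternating i) {a : Fin d}
    (ha : a ≠ i (Fin.last _)) :
    IsAlternating (k := k + 1) (Fin.snoc (α := fun _ => Fin d) i a) := by
  intro s
  induction s using Fin.lastCases with
  | last => rw [Fin.succ_last, Fin.snoc_last, Fin.snoc_castSucc]; exact ha
  | cast s => rw [Fin.succ_castSucc, Fin.snoc_castSucc, Fin.snoc_castSucc]; exact hi s

theorem IsHashPath.restrict {h : Fin d → U → Fin m} {k r : ℕ} (hr : r ≤ k) {x : Fin (k + 2) → U}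
    {i : Fin (k + 1) → Fin d} (hp : IsHashPath h x i) :
    IsHashPath h (k := r) (fun s => x (Fin.castLE (by omega) s))
      (fun s => i (Fin.castLE (by omega) s)) :=
  ⟨hp.injective.comp (Fin.castLE_injective _), fun s => hp.meet (Fin.castLE (by omega) s)⟩

/-- The last edge of the path meets earlier edges of the path in the parts `a` and `b`. -/
def IsClosedBy (h : Fin d → U → Fin m) {k : ℕ} (x : Fin (k + 2) → U)
    (a b : Fin d) (p p' : Fin (k + 1)) : Prop :=
  h a (x (Fin.last _)) = h a (x p.castSucc) ∧ h b (x (Fin.last _)) = h b (x p'.castSucc)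

/-- A longest path in a core closes up twice at its end. -/
theorem exists_closed_path (hd : 3 ≤ d) {h : Fin d → U → Fin m} {T : Finset U}
    (hne : T.Nonempty) (hT : ∀ x ∈ T, ∀ i, ∃ y ∈ T, y ≠ x ∧ h i y = h i x) :
    ∃ (k : ℕ) (x : Fin (k + 2) → U) (i : Fin (k + 1) → Fin d) (a b : Fin d) (p p' : Fin (k + 1)),
      (∀ s, x s ∈ T) ∧ IsHashPath h x i ∧ IsAlternating i ∧ (a ≠ b ∧ a ≠ i (Fin.last _) ∧
        b ≠ i (Fin.last _)) ∧ IsClosedBy h x a b p p' := by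
  classical
  set P : ℕ → Prop := fun k => ∃ (x : Fin (k + 2) → U) (i : Fin (k + 1) → Fin d),
    (∀ s, x s ∈ T) ∧ IsHashPath h x i ∧ IsAlternating i with hP
  have h0 : P 0 := by
    obtain ⟨x, hx⟩ := hne
    obtain ⟨y, hy, hyx, e⟩ := hT x hx ⟨0, by omega⟩
    refine ⟨![x, y], fun _ => ⟨0, by omega⟩, ?_, ⟨?_, ?_⟩, fun s => s.elim0⟩
    · simp [Fin.forall_fin_two, hx, hy]
    · intro s s' hs
      fin_cases s <;> fin_cases s' <;> simp_all [eq_comm]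
    · intro s
      fin_cases s
      simpa using e
  have hbig : ¬ P (#T) := by
    rintro ⟨x, i, hx, hp, -⟩
    have := card_le_card_of_injOn x (s := univ) (t := T) (fun s _ => hx s)
      hp.injective.injOn
    simp at this
  -- Only inextensibility is needed: some length occurs such that the next one does not.
  obtain ⟨k, hk, hk'⟩ : ∃ k, P k ∧ ¬ P (k + 1) := by
    by_contra hcon
    push Not at hcon
    exact hbig (Nat.rec (motive := P) h0 hcon _)
  obtain ⟨x, i, hx, hp, hi⟩ := hk
  -- The core supplies a neighbour of the last edge in part `a`. A new key would extend the path and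
  -- keep it alternating, so the neighbour is already on the path.
  have hclose : ∀ a, a ≠ i (Fin.last _) → ∃ p : Fin (k + 1),
      h a (x (Fin.last _)) = h a (x p.castSucc) := by
    intro a ha
    obtain ⟨y, hy, hyx, e⟩ := hT _ (hx (Fin.last _)) a
    by_cases hin : ∀ s, x s ≠ y
    · refine absurd ⟨_, _, ?_, hp.snoc hin e, hi.snoc ha⟩ hk'
      intro s
      induction s using Fin.lastCases with
      | last => rw [Fin.snoc_last]; exact hy
      | cast s => rw [Fin.snoc_castSucc]; exact hx s
    · push Not at hin
      obtain ⟨s, rfl⟩ := hin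
      induction s using Fin.lastCases with
      | last => exact absurd rfl hyx
      | cast s => exact ⟨s, e.symm⟩
  obtain ⟨a, b, hab, ha, hb⟩ := exists_ne_ne_ne hd (i (Fin.last _))
  obtain ⟨p, hp1⟩ := hclose a ha
  obtain ⟨p', hp2⟩ := hclose b hb
  exact ⟨k, x, i, a, b, p, p', hx, hp, hi, ⟨hab, ha, hb⟩, hp1, hp2⟩

-- Each entry after the first avoids its predecessor. This factor `d - 1`, rather than `d`, is what
-- lets `m ≥ (1 + ε)(d - 1)n` suffice.
open Classical in
theorem card_isAlternating_le (d k : ℕ) :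
    #{i : Fin (k + 1) → Fin d | IsAlternating i} ≤ d * (d - 1) ^ k := by
  induction k with
  | zero => refine (card_filter_le _ _).trans ?_; simp
  | succ k ih =>
    rw [pow_succ, ← mul_assoc, mul_comm _ (d - 1)]
    refine (card_le_mul_card_image_of_maps_to (f := fun i => fun s : Fin (k + 1) => i s.castSucc)
      (t := {i : Fin (k + 1) → Fin d | IsAlternating i}) ?_ (d - 1) ?_).trans
      (Nat.mul_le_mul_left _ ih)
    · intro i hi
      simp only [mem_filter, mem_univ, true_and] at hi ⊢
      exact fun s => hi s.castSucc
    · intro i₀ _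
      have : #(univ.erase (i₀ (Fin.last _))) = d - 1 := by simp
      rw [← this]
      refine card_le_card_of_injOn (fun i => i (Fin.last _)) ?_ ?_
      · intro i hi
        simp only [coe_filter, mem_filter, mem_univ, true_and, Set.mem_ofPred_eq] at hi
        simp only [coe_erase, coe_univ, Set.mem_sdiff, Set.mem_univ, Set.mem_singleton_iff,
          true_and]
        rw [← hi.2]
        exact hi.1 (Fin.last k)
      · intro i hi i' hi' e
        simp only [coe_filter, mem_filter, mem_univ, true_and, Set.mem_ofPred_eq] at hi hi'
        ext1 s
        induction s using Fin.lastCases with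
        | last => exact e
        | cast s => exact (congrFun hi.2 s).trans (congrFun hi'.2 s).symm

end Core

/-! ### Path witnesses and their probabilities. -/

section Witnesses

variable {U : Type*} {c d ℓ m k : ℕ}

/-- The last key can collide with at most one of the earlier keys, since these have distinct values.
That pair is the permitted exception; without a collision any pair serves. -/
theorem Separated.of_injective_castSucc {q : Fin c → U → Fin ℓ} {x : Fin (k + 2) → U} {j : Fin c}
    (h : Function.Injective fun s : Fin (k + 1) => q j (x s.castSucc)) : Separated q x := by
  by_cases hl : ∃ s : Fin (k + 1), q j (x s.castSucc) = q j (x (Fin.last _))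
  · obtain ⟨a, ha⟩ := hl
    refine ⟨j, a.castSucc, Fin.last _, (Fin.castSucc_lt_last a).ne, fun s hs hs' s' hne => ?_⟩
    obtain ⟨s, rfl⟩ := Fin.exists_castSucc_eq.2 hs'
    have hsa : a ≠ s := fun h => hs (by rw [h])
    induction s' using Fin.lastCases with
    | last => rw [← ha]; exact fun e => hsa (h e)
    | cast s' => exact fun e => hne (congrArg _ (h e))
  · push Not at hl
    refine ⟨j, 0, Fin.last _, (Fin.last_pos).ne, fun s hs hs' s' hne => ?_⟩
    obtain ⟨s, rfl⟩ := Fin.exists_castSucc_eq.2 hs'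
    induction s' using Fin.lastCases with
    | last => exact (hl s).symm
    | cast s' => exact fun e => hne (congrArg _ (h e))

/-- Unless `q` separates `x`, some prefix of `x` is just barely separated. -/
theorem separated_or_exists_prefix (hc : 0 < c) (q : Fin c → U → Fin ℓ) (x : Fin (k + 2) → U) :
    Separated q x ∨ ∃ (r : ℕ) (hr : r ≤ k),
      Separated q (fun s : Fin (r + 2) => x (Fin.castLE (by omega) s)) ∧
      ∀ j, ¬ Function.Injective (q j ∘ fun s : Fin (r + 2) => x (Fin.castLE (by omega) s)) := by
  by_contra hcon
  push Not at hcon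
  obtain ⟨hns, hcon⟩ := hcon
  -- Two keys are always separated, being themselves the exceptional pair. Under the contrary
  -- assumption a separated prefix has an injective `q j`, so one more key can be added.
  have key : ∀ r (hr : r ≤ k),
      Separated q (fun s : Fin (r + 2) => x (Fin.castLE (by omega) s)) := by
    intro r
    induction r with
    | zero =>
      intro _
      refine ⟨⟨0, hc⟩, 0, 1, by simp, fun s hs hs' => ?_⟩
      fin_cases s <;> simp_all
    | succ r ih =>
      intro hr
      obtain ⟨j, hj⟩ := hcon r (by omega) (ih (by omega))
      exact Separated.of_injective_castSucc (k := r + 1) (j := j) hj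
  exact hns (key k le_rfl)

/-- Separation makes the `k + 1` meeting equations cost `1 / m` each, and the `c` independent
functions `g_j` each fail to be injective with probability at most `(k + 2)² · 2 / ℓ`. -/
theorem uniformProb_path_le [NeZero m] {F : Finset (U → Fin ℓ)} {H : Finset (U → Fin m)}
    (hF : IsUniversalClass 2 F) (hne : H.Nonempty) (hH : IsIndependentClass 2 H)
    (x : Fin (k + 2) → U) (i : Fin (k + 1) → Fin d) :
    uniformProb (hashClassZ c d F H) (fun w => (Separated w.2.1 x ∧
        ∀ j, ¬ Function.Injective (w.2.1 j ∘ x)) ∧ IsHashPath (hashSeq w) x i) ≤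
      (((k + 2 : ℕ) : ℝ) ^ 2 * (2 / ℓ)) ^ c * (1 / (m : ℝ) ^ (k + 1)) := by
  classical
  by_cases hx : Function.Injective x
  swap
  · have : uniformProb (hashClassZ c d F H) (fun w => (Separated w.2.1 x ∧
        ∀ j, ¬ Function.Injective (w.2.1 j ∘ x)) ∧ IsHashPath (hashSeq w) x i) = 0 := by
      rw [uniformProb_eq, filter_false_of_mem (fun w _ h => hx h.2.injective)]
      simp
    rw [this]; positivity
  have heq := uniformProb_equations_le (m := m) (fun s : Fin (k + 1) => (i s, s.succ))
    (fun s s' h => Fin.succ_injective _ (Prod.ext_iff.1 h).2) (fun s => s.castSucc)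
    (fun s => Fin.castSucc_lt_succ)
  rw [Fintype.card_fin] at heq
  refine (uniformProb_mono _ fun w _ hw => ⟨hw.1, hw.2.meet⟩).trans
    ((uniformProb_hashClassZ_le hne hH hx
      (fun q => Separated q x ∧ ∀ j, ¬ Function.Injective (q j ∘ x)) (fun q hq => hq.1)
      (fun v => ∀ s, v (i s) s.succ = v (i s) s.castSucc)).trans ?_)
  refine mul_le_mul ?_ heq (uniformProb_nonneg _ _) (by positivity)
  refine (uniformProb_mono _ fun q _ hq => hq.2).trans ?_
  rw [uniformProb_piFinset_forall F (fun g => ¬ Function.Injective (g ∘ x))]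
  exact pow_le_pow_left₀ (uniformProb_nonneg _ _)
    (hF.uniformProb_not_injective_le (by norm_num) hx) _

/-- The two closing equations join the `k + 1` meeting equations. All are solved for different
places: at the last key, `a`, `b` and the part of arrival are distinct. -/
theorem uniformProb_closed_path_le [NeZero m] {F : Finset (U → Fin ℓ)} {H : Finset (U → Fin m)}
    (hne : H.Nonempty) (hH : IsIndependentClass 2 H) (x : Fin (k + 2) → U)
    (i : Fin (k + 1) → Fin d) (a b : Fin d) (p p' : Fin (k + 1))
    (hab : a ≠ b ∧ a ≠ i (Fin.last _) ∧ b ≠ i (Fin.last _)) :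
    uniformProb (hashClassZ c d F H) (fun w => Separated w.2.1 x ∧
        IsHashPath (hashSeq w) x i ∧ IsClosedBy (hashSeq w) x a b p p') ≤
      1 / (m : ℝ) ^ (k + 3) := by
  classical
  by_cases hx : Function.Injective x
  swap
  · have : uniformProb (hashClassZ c d F H) (fun w => Separated w.2.1 x ∧
        IsHashPath (hashSeq w) x i ∧ IsClosedBy (hashSeq w) x a b p p') = 0 := by
      rw [uniformProb_eq, filter_false_of_mem (fun w _ h => hx h.2.1.injective)]
      simp
    rw [this]; positivity
  have hlast : ∀ s : Fin (k + 1), s.succ = Fin.last (k + 1) → s = Fin.last k := fun s h =>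
    Fin.succ_injective _ (h.trans (Fin.succ_last k).symm)
  have heq := uniformProb_equations_le (m := m) (κ := Fin (k + 1) ⊕ Bool)
    (Sum.elim (fun s => (i s, s.succ)) fun e => (if e then a else b, Fin.last (k + 1)))
    (by
      rintro (s | _ | _) (s' | _ | _) h <;> simp only [Sum.elim_inl, Sum.elim_inr, Prod.mk.injEq,
        if_true, Bool.false_eq_true, if_false] at h
      · rw [Fin.succ_injective _ h.2]
      · exact absurd (hlast s h.2 ▸ h.1).symm hab.2.2
      · exact absurd (hlast s h.2 ▸ h.1).symm hab.2.1
      · exact absurd (hlast s' h.2.symm ▸ h.1) hab.2.2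
      · rfl
      · exact absurd h.1.symm hab.1
      · exact absurd (hlast s' h.2.symm ▸ h.1) hab.2.1
      · exact absurd h.1 hab.1
      · rfl)
    (Sum.elim (fun s => s.castSucc) fun e => if e then p.castSucc else p'.castSucc)
    (by
      rintro (s | _ | _)
      · exact Fin.castSucc_lt_succ
      · exact Fin.castSucc_lt_last _
      · exact Fin.castSucc_lt_last _)
  have hcard : Fintype.card (Fin (k + 1) ⊕ Bool) = k + 3 := by simp
  rw [hcard] at heq
  refine (uniformProb_mono _ fun w _ hw => ⟨hw.1, ?_⟩).trans
    ((uniformProb_hashClassZ_le hne hH hx (fun q => Separated q x) (fun q hq => hq) _).trans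
      ((mul_le_of_le_one_left (uniformProb_nonneg _ _) ?_).trans heq))
  · rw [uniformProb_eq]
    exact div_le_one_of_le₀ (by exact_mod_cast card_filter_le _ _) (by positivity)
  · rintro (s | _ | _)
    · exact hw.2.1.meet s
    · exact hw.2.2.2
    · exact hw.2.2.1

open Classical in
/-- Keys and meeting parts of candidate paths with `k + 2` edges. -/
noncomputable def pathIndices (S : Finset U) (d k : ℕ) :
    Finset ((Fin (k + 2) → U) × (Fin (k + 1) → Fin d)) :=
  (Fintype.piFinset fun _ => S) ×ˢ univ.filter fun i => IsAlternating i

theorem card_pathIndices_le (S : Finset U) (d k : ℕ) :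
    #(pathIndices S d k) ≤ #S ^ (k + 2) * (d * (d - 1) ^ k) := by
  classical
  rw [pathIndices, card_product]
  refine Nat.mul_le_mul (by simp [Fintype.card_piFinset]) ?_
  exact card_isAlternating_le d k

/-- A hash function sequence that is not suitable has a separated closed path or a path that is
just barely separated. -/
theorem exists_path_of_not_isSuitable (hc : 0 < c) (hd : 3 ≤ d) {S : Finset U}
    {w : HashComponents U c d ℓ m} (hw : ¬ IsSuitable S (hashSeq w)) :
    (∃ k ∈ range #S, ∃ y ∈ pathIndices S d k,
      (Separated w.2.1 y.1 ∧ ∀ j, ¬ Function.Injective (w.2.1 j ∘ y.1)) ∧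
        IsHashPath (hashSeq w) y.1 y.2) ∨
    ∃ k ∈ range #S, ∃ y ∈ pathIndices S d k,
      ∃ e ∈ (univ : Finset ((Fin d × Fin d) × (Fin (k + 1) × Fin (k + 1)))).filter
        (fun e => e.1.1 ≠ e.1.2 ∧ e.1.1 ≠ y.2 (Fin.last _) ∧ e.1.2 ≠ y.2 (Fin.last _)),
      Separated w.2.1 y.1 ∧ IsHashPath (hashSeq w) y.1 y.2 ∧
        IsClosedBy (hashSeq w) y.1 e.1.1 e.1.2 e.2.1 e.2.2 := by
  classical
  obtain ⟨T, hTS, hne, hT⟩ := exists_core_of_not_isSuitable S hw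
  obtain ⟨k, x, i, a, b, p, p', hx, hp, hi, hab, hcl⟩ := exists_closed_path hd hne hT
  have hk : k + 2 ≤ #S := by
    have := card_le_card_of_injOn x (s := univ) (t := S) (fun s _ => hTS (hx s))
      hp.injective.injOn
    simpa using this
  rcases separated_or_exists_prefix hc w.2.1 x with hs | ⟨r, hr, hs, hs'⟩
  · refine Or.inr ⟨k, mem_range.2 (by omega), (x, i), ?_, ((a, b), (p, p')), ?_, hs, hp, hcl⟩
    · simp [pathIndices, hi, fun s => hTS (hx s)]
    · simpa using hab
  -- The closing conditions are dropped here; the failure of injectivity for every `g_j` makes up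
  -- for them.
  · refine Or.inl ⟨r, mem_range.2 (by omega), (_, _), ?_, ⟨hs, hs'⟩, hp.restrict hr⟩
    simp only [pathIndices, mem_product, Fintype.mem_piFinset, mem_filter, mem_univ, true_and]
    exact ⟨fun s => hTS (hx _), fun s => hi (Fin.castLE (by omega) s)⟩

theorem uniformProb_not_isSuitable_le [NeZero m] {F : Finset (U → Fin ℓ)}
    {H : Finset (U → Fin m)} (hF : IsUniversalClass 2 F) (hne : H.Nonempty)
    (hH : IsIndependentClass 2 H) (hc : 0 < c) (hd : 3 ≤ d) (S : Finset U) :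
    uniformProb (hashClassZ c d F H) (fun w => ¬ IsSuitable S (hashSeq w)) ≤
      ∑ k ∈ range #S, (#S ^ (k + 2) * (d * (d - 1) ^ k) : ℕ) *
        ((((k + 2 : ℕ) : ℝ) ^ 2 * (2 / ℓ)) ^ c * (1 / (m : ℝ) ^ (k + 1)) +
          (d * d * ((k + 1) * (k + 1)) : ℕ) * (1 / (m : ℝ) ^ (k + 3))) := by
  classical
  refine (uniformProb_mono _ fun w _ hw => exists_path_of_not_isSuitable hc hd hw).trans
    ((uniformProb_or_le _ _ _).trans ?_)
  simp only [mul_add (R := ℝ), sum_add_distrib]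
  refine add_le_add ?_ ?_
  · refine (uniformProb_exists_le _ _ _).trans (sum_le_sum fun k _ => ?_)
    have h := uniformProb_exists_le_card_mul (hashClassZ c d F H) (pathIndices S d k) _
      (fun y _ => uniformProb_path_le hF hne hH y.1 y.2)
    exact h.trans (mul_le_mul_of_nonneg_right (Nat.cast_le.2 (card_pathIndices_le S d k))
      (by positivity))
  · refine (uniformProb_exists_le _ _ _).trans (sum_le_sum fun k _ => ?_)
    have h : ∀ y ∈ pathIndices S d k, uniformProb (hashClassZ c d F H) (fun w =>
        ∃ e ∈ (univ : Finset ((Fin d × Fin d) × (Fin (k + 1) × Fin (k + 1)))).filter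
          (fun e => e.1.1 ≠ e.1.2 ∧ e.1.1 ≠ y.2 (Fin.last _) ∧ e.1.2 ≠ y.2 (Fin.last _)),
        Separated w.2.1 y.1 ∧ IsHashPath (hashSeq w) y.1 y.2 ∧
          IsClosedBy (hashSeq w) y.1 e.1.1 e.1.2 e.2.1 e.2.2) ≤
        (d * d * ((k + 1) * (k + 1)) : ℕ) * (1 / (m : ℝ) ^ (k + 3)) := by
      intro y _
      refine (uniformProb_exists_le_card_mul _ _ _ (b := 1 / (m : ℝ) ^ (k + 3))
        fun e he => ?_).trans ?_
      · exact uniformProb_closed_path_le hne hH y.1 y.2 _ _ _ _ (mem_filter.1 he).2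
      · refine mul_le_mul_of_nonneg_right (Nat.cast_le.2 ((card_filter_le _ _).trans ?_))
          (by positivity)
        rw [card_univ, Fintype.card_prod, Fintype.card_prod, Fintype.card_prod, Fintype.card_fin,
          Fintype.card_fin]
    refine (uniformProb_exists_le_card_mul _ _ _ h).trans ?_
    have hcard : (#(pathIndices S d k) : ℝ) ≤ (#S ^ (k + 2) * (d * (d - 1) ^ k) : ℕ) :=
      Nat.cast_le.2 (card_pathIndices_le S d k)
    refine mul_le_mul_of_nonneg_right hcard ?_
    positivity

end Witnesses

/-! ### Numerical estimates and summation over path lengths. -/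

theorem sq_le_two_mul_pow {δ : ℝ} (hδ : 0 < δ) {c n ℓ : ℕ} (hc : 2 / δ ≤ (c : ℝ)) (hn : 1 ≤ n)
    (hℓ : ℓ = ⌊(n : ℝ) ^ δ⌋₊ ∨ ℓ = ⌈(n : ℝ) ^ δ⌉₊) :
    0 < ℓ ∧ (n : ℝ) ^ 2 ≤ (2 * ℓ : ℝ) ^ c := by
  have hn' : (1 : ℝ) ≤ n := by exact_mod_cast hn
  have h1 : 1 ≤ (n : ℝ) ^ δ := Real.one_le_rpow hn' hδ.le
  have hfl : 1 ≤ ⌊(n : ℝ) ^ δ⌋₊ := by rwa [Nat.one_le_floor_iff]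
  have hle : ⌊(n : ℝ) ^ δ⌋₊ ≤ ℓ := by
    rcases hℓ with rfl | rfl
    · exact le_rfl
    · exact Nat.floor_le_ceil _
  -- As `n ^ δ ≥ 1`, rounding loses at most a factor `2`.
  have h2 : (n : ℝ) ^ δ ≤ 2 * ℓ := by
    have h3 := Nat.lt_floor_add_one ((n : ℝ) ^ δ)
    have h4 : (⌊(n : ℝ) ^ δ⌋₊ : ℝ) ≤ ℓ := by exact_mod_cast hle
    have h5 : (1 : ℝ) ≤ ⌊(n : ℝ) ^ δ⌋₊ := by exact_mod_cast hfl
    linarith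
  refine ⟨by omega, ?_⟩
  calc (n : ℝ) ^ 2 = (n : ℝ) ^ (2 : ℝ) := by norm_cast
    _ ≤ (n : ℝ) ^ (δ * c) := by
        refine Real.rpow_le_rpow_of_exponent_le hn' ?_
        rw [div_le_iff₀ hδ] at hc
        linarith
    _ = ((n : ℝ) ^ δ) ^ c := by rw [Real.rpow_mul (by positivity), Real.rpow_natCast]
    _ ≤ _ := pow_le_pow_left₀ (by positivity) h2 _

/-- The contribution of paths with `k + 2` edges decays geometrically in `k`. -/
theorem path_term_le {ρ : ℝ} {c d n m ℓ k : ℕ} (hc : 0 < c) (hd : 1 ≤ d) (hn : 0 < n)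
    (hℓ : 0 < ℓ) (hnℓ : (n : ℝ) ^ 2 ≤ (2 * ℓ : ℝ) ^ c) (hnm : (n : ℝ) ≤ m)
    (hρ : ((d : ℝ) - 1) * n ≤ ρ * m) :
    ((n ^ (k + 2) * (d * (d - 1) ^ k) : ℕ) : ℝ) *
        ((((k + 2 : ℕ) : ℝ) ^ 2 * (2 / ℓ)) ^ c * (1 / (m : ℝ) ^ (k + 1)) +
          (d * d * ((k + 1) * (k + 1)) : ℕ) * (1 / (m : ℝ) ^ (k + 3))) ≤
      (d * 4 ^ c + d ^ 3) * (((k + 2 : ℕ) : ℝ) ^ (2 * c) * ρ ^ k) / n := by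
  have hn0 : (0 : ℝ) < n := by exact_mod_cast hn
  have hm0 : (0 : ℝ) < m := hn0.trans_le hnm
  have hℓ0 : (0 : ℝ) < ℓ := by exact_mod_cast hℓ
  have hd1 : (0 : ℝ) ≤ (d : ℝ) - 1 := by
    have : (1 : ℝ) ≤ d := by exact_mod_cast hd
    linarith
  have hq : (((d : ℝ) - 1) * n / m) ^ k ≤ ρ ^ k :=
    pow_le_pow_left₀ (by positivity) ((div_le_iff₀ hm0).2 hρ) k
  set K : ℝ := ((k + 2 : ℕ) : ℝ) with hK
  have hK1 : (1 : ℝ) ≤ K := by rw [hK]; exact_mod_cast (by omega : 1 ≤ k + 2)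
  set Q : ℝ := (((d : ℝ) - 1) * n / m) ^ k with hQ
  have hQ0 : 0 ≤ Q := by positivity
  have hρ0 : 0 ≤ ρ ^ k := hQ0.trans hq
  -- The barely separated paths. Together with the factor `2 ^ c` from `2`-universality, the `2 ^ c`
  -- from rounding `ℓ` gives the constant `4 ^ c`.
  have hA : (n : ℝ) ^ 2 / m * (1 / (ℓ : ℝ) ^ c) ≤ 2 ^ c / n := by
    rw [mul_pow] at hnℓ
    rw [div_mul_div_comm, mul_one, div_le_div_iff₀ (by positivity) hn0]
    calc (n : ℝ) ^ 2 * n ≤ (2 ^ c * ℓ ^ c) * m := by gcongr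
      _ = _ := by ring
  -- The closed paths: one more equation than keys leaves a net factor `1 / n`.
  have hB : (n : ℝ) ^ 2 / m ^ 3 ≤ 1 / n := by
    rw [div_le_div_iff₀ (by positivity) hn0, one_mul, ← pow_succ]
    gcongr
  have hKk : ((k : ℝ) + 1) * (k + 1) ≤ K ^ (2 * c) := by
    calc ((k : ℝ) + 1) * (k + 1) ≤ K * K := by rw [hK]; push_cast; gcongr <;> norm_num
      _ = K ^ 2 := by ring
      _ ≤ K ^ (2 * c) := pow_le_pow_right₀ hK1 (by omega)
  push_cast [Nat.cast_sub hd]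
  calc _ = d * 2 ^ c * K ^ (2 * c) * Q * ((n : ℝ) ^ 2 / m * (1 / (ℓ : ℝ) ^ c)) +
        d ^ 3 * (((k : ℝ) + 1) * (k + 1)) * Q * ((n : ℝ) ^ 2 / m ^ 3) := by
        rw [hQ, hK]
        push_cast
        rw [div_pow, mul_pow, mul_pow, div_pow, ← pow_mul]
        field_simp
        ring
    _ ≤ d * 2 ^ c * K ^ (2 * c) * ρ ^ k * (2 ^ c / n) +
        d ^ 3 * K ^ (2 * c) * ρ ^ k * (1 / n) := by gcongr
    _ = _ := by
        rw [show (4 : ℝ) = 2 * 2 by norm_num, mul_pow]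
        ring

theorem mainTheorem8 (ε δ : ℝ) (hε : 0 < ε) (hδ0 : 0 < δ) (hδ1 : δ < 1)
    (d : ℕ) (hd : 3 ≤ d) (c : ℕ) (hc : 2 / δ ≤ (c : ℝ)) :
    ∃ C : ℝ, ∀ n m ℓ : ℕ, 1 ≤ n →
      (1 + ε) * ((d : ℝ) - 1) * (n : ℝ) ≤ (m : ℝ) →
      (ℓ = ⌊(n : ℝ) ^ δ⌋₊ ∨ ℓ = ⌈(n : ℝ) ^ δ⌉₊) →
      ∀ (U : Type*) [Fintype U] (F : Finset (U → Fin ℓ)) (H : Finset (U → Fin m)),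
        F.Nonempty → IsUniversalClass 2 F →
        H.Nonempty → IsIndependentClass 2 H →
        ∀ S : Finset U, S.card = n →
          uniformProb (hashClassZ c d F H) (fun w => ¬ IsSuitable S (hashSeq w))
            ≤ C / (n : ℝ) := by

  have hc0 : 0 < c := by
    have : (0 : ℝ) < c := (by positivity : (0 : ℝ) < 2 / δ).trans_le hc
    exact_mod_cast this
  -- An upper bound for the growth ratio `(d - 1) n / m` of the expected number of paths.
  set ρ : ℝ := 1 / (1 + ε) with hρ
  have hρ0 : 0 < ρ := by positivity
  have hρ1 : ρ < 1 := by rw [hρ, div_lt_one (by positivity)]; linarith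
  have hsum : Summable fun k : ℕ => ((k + 2 : ℕ) : ℝ) ^ (2 * c) * ρ ^ k := by
    have h := (summable_nat_add_iff 2).2 (summable_pow_mul_geometric_of_norm_lt_one (2 * c)
      (r := ρ) (by rwa [Real.norm_of_nonneg hρ0.le]))
    refine (h.mul_right (ρ ^ 2)⁻¹).congr fun k => ?_
    rw [pow_add]
    field_simp
  -- The full series replaces the sum over `k < n`, so the constant does not depend on `n`.
  refine ⟨(d * 4 ^ c + d ^ 3) * ∑' k : ℕ, ((k + 2 : ℕ) : ℝ) ^ (2 * c) * ρ ^ k, ?_⟩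
  intro n m ℓ hn hm hℓ U _ F H _ hF hHne hH S hS
  obtain ⟨hℓ0, hnℓ⟩ := sq_le_two_mul_pow hδ0 hc hn hℓ
  have hn0 : (0 : ℝ) < n := by exact_mod_cast hn
  have hd3 : (3 : ℝ) ≤ d := by exact_mod_cast hd
  have hle : ((d : ℝ) - 1) * n ≤ ρ * m := by
    rw [hρ, one_div_mul_eq_div, le_div_iff₀ (by positivity)]
    linarith
  have hnm : (n : ℝ) ≤ m := by
    refine le_trans ?_ hm
    nlinarith [mul_pos hε hn0]
  have : NeZero m := ⟨by rintro rfl; simp at hnm; omega⟩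
  refine (uniformProb_not_isSuitable_le hF hHne hH hc0 hd S).trans ?_
  rw [hS]
  refine (sum_le_sum fun k _ => path_term_le hc0 (by omega) hn hℓ0 hnℓ hnm hle).trans ?_
  rw [← sum_div, ← mul_sum]
  gcongr
  exact hsum.sum_le_tsum _ fun k _ => by positivity
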